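/- **Conventions.** Let $G$ be a group. For subsets $T,V\subseteq G$, $T$ is a *monotile* of $V$ if there is $C\subseteq G$ such that the sets $cT$ ($c\in C$) are pairwise disjoint with union $V$. A *right Følner sequence* of $G$ is a sequence $(F_n)_{n\in\mathbb N}$ of non-empty finite subsets of $G$ with $\lim_{n\to\infty}|F_ns\setminus F_n|/|F_n|=0$ for every $s\in G$. A sequence $(F_n)_{n\in\mathbb N}$ of non-empty finite subsets of $G$ is *locally monotileable* if $F_0=\{1\}$ and $F_n$ is a monotile of $F_{n+1}$ for every $n\in\mathbb N$; it is *congruent* if moreover there are finite sets $K_n\subseteq G$ ($n\in\mathbb N$) with $K_0=\{1\}$, $1\in K_n$ and $F_{n+1}=\bigsqcup_{k\in K_{n+1}}kF_n$ for every $n\in\mathbb N$; it is *exhaustive* if $\bigcup_{n}F_n=G$. A countable group is *locally monotileable* if it has a locally monotileable right Følner sequence, and *congruent monotileable* if it has an exhaustive congruent right Følner sequence. The transfinite upper central series of $G$ is given by $Z_0(G)=\{1\}$, $Z_{\alpha+1}(G)/Z_\alpha(G)=Z(G/Z_\alpha(G))$, and $Z_\lambda(G)=\bigcup_{\beta<\lambda}Z_\beta(G)$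 for limit ordinals $\lambda$. The group $G$ is *hypercentral* if $Z_\alpha(G)=G$ for some ordinal $\alpha$; its *length* is then the least such $\alpha$. A group is *virtually hypercentral of length $<\omega^2$* (respectively, *virtually nilpotent*) if it has a subgroup of finite index that is hypercentral of length $<\omega^2$ (respectively, nilpotent). **Theorem 1.6.** A countable group is locally monotileable if and only if it is congruent monotileable. Every countable group that is virtually hypercentral of length $<\omega^2$ is locally monotileable and, equivalently, congruent monotileable. In particular, every countable virtually nilpotent group is congruent monotileable. -/

import Mathlib

open scoped Pointwise Topology

namespace Monotiles

/-- The set `V` is partitioned by left translates of `T`: the sets `c • T`, `c ∈ C`, are pairwise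
disjoint and their union is `V`. -/
def IsTiling {S : Type*} [Monoid S] (C T V : Set S) : Prop :=
  C.PairwiseDisjoint (fun c => c • T) ∧ ⋃ c ∈ C, c • T = V

/-- `T` is a monotile of `V`. -/
def IsMonotile {S : Type*} [Monoid S] (T V : Set S) : Prop :=
  ∃ C : Set S, IsTiling C T V

/-- A right Følner sequence of `S`: a sequence of non-empty finite subsets with
`|F n s \ F n| / |F n| → 0` for every `s`. -/
def IsRightFolnerSeq {S : Type*} [Monoid S] (F : ℕ → Finset S) : Prop :=
  (∀ n, (F n).Nonempty) ∧
    ∀ s : S, Filter.Tendsto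
      (fun n => ((((fun x => x * s) '' (F n : Set S)) \ (F n : Set S)).ncard : ℝ) / ((F n).card : ℝ))
      Filter.atTop (𝓝 0)

/-- A locally monotileable sequence of finite subsets of `S`. -/
def IsLocallyMonotileableSeq {S : Type*} [Monoid S] (F : ℕ → Finset S) : Prop :=
  F 0 = {1} ∧ ∀ n, IsMonotile (F n : Set S) (F (n + 1) : Set S)

/-- `K` is a tiling sequence associated to the sequence `F`: `F (n + 1)` is the disjoint union of
the translates `k • F n`, `k ∈ K (n + 1)`. -/
def IsTilingSeq {S : Type*} [Monoid S] (F K : ℕ → Finset S) : Prop :=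
  K 0 = {1} ∧ ∀ n, IsTiling (K (n + 1) : Set S) (F n : Set S) (F (n + 1) : Set S)

/-- A congruent sequence: a locally monotileable one that admits a tiling sequence whose terms all
contain `1`. -/
def IsCongruentSeq {S : Type*} [Monoid S] (F : ℕ → Finset S) : Prop :=
  IsLocallyMonotileableSeq F ∧ ∃ K : ℕ → Finset S, IsTilingSeq F K ∧ ∀ n, (1 : S) ∈ K n

/-- The sequence `F` exhausts `S`. -/
def IsExhaustiveSeq {S : Type*} (F : ℕ → Finset S) : Prop :=
  ⋃ n, (F n : Set S) = Set.univ

/-- Local monotileability (meant for countable monoids). Right amenability, that is, the existence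
of a right Følner net, is contained in the existence of a right Følner sequence. -/
def IsLocallyMonotileable (S : Type*) [Monoid S] : Prop :=
  ∃ F : ℕ → Finset S, IsRightFolnerSeq F ∧ IsLocallyMonotileableSeq F

/-- Congruent monotileability (meant for countable monoids). -/
def IsCongruentMonotileable (S : Type*) [Monoid S] : Prop :=
  ∃ F : ℕ → Finset S, IsRightFolnerSeq F ∧ IsCongruentSeq F ∧ IsExhaustiveSeq F

/-- The transfinite upper central series, bundled with normality of its terms:
`Z 0 = 1`, `Z (α + 1)` is the preimage of the centre of `G ⧸ Z α`, and at a limit ordinal `Z α` is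
the supremum (equivalently, since the series increases, the union) of the earlier terms. -/
noncomputable def upperCentralAux (G : Type*) [Group G] (α : Ordinal) :
    {H : Subgroup G // H.Normal} :=
  Ordinal.limitRecOn α
    ⟨⊥, inferInstance⟩
    (fun _ N => haveI := N.2
      ⟨(Subgroup.center (G ⧸ N.1)).comap (QuotientGroup.mk' N.1), inferInstance⟩)
    (fun o _ ih => haveI : ∀ β : Set.Iio o, (ih β.1 β.2).1.Normal := fun β => (ih β.1 β.2).2
      ⟨⨆ β : Set.Iio o, (ih β.1 β.2).1, inferInstance⟩)

/-- The `α`-th term `Z_α(G)` of the transfinite upper central series of `G`. -/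
noncomputable def upperCentral (G : Type*) [Group G] (α : Ordinal) : Subgroup G :=
  (upperCentralAux G α).1

instance upperCentral_normal (G : Type*) [Group G] (α : Ordinal) : (upperCentral G α).Normal :=
  (upperCentralAux G α).2

theorem upperCentral_zero (G : Type*) [Group G] : upperCentral G 0 = ⊥ := by
  simp [upperCentral, upperCentralAux]

theorem upperCentral_succ (G : Type*) [Group G] (α : Ordinal) :
    upperCentral G (α + 1) =
      (Subgroup.center (G ⧸ upperCentral G α)).comap (QuotientGroup.mk' (upperCentral G α)) := by
  conv_lhs => rw [upperCentral, upperCentralAux, Ordinal.limitRecOn_add_one]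
  rfl

theorem upperCentral_limit (G : Type*) [Group G] (α : Ordinal) (hα : Order.IsSuccLimit α) :
    upperCentral G α = ⨆ β : Set.Iio α, upperCentral G β.1 := by
  conv_lhs => rw [upperCentral, upperCentralAux, Ordinal.limitRecOn_limit _ _ _ _ hα]
  rfl

/-- `G` is hypercentral: its transfinite upper central series reaches `G`. -/
def IsHypercentral.{u} (G : Type u) [Group G] : Prop :=
  ∃ α : Ordinal.{u}, upperCentral G α = ⊤

/-- The length of a hypercentral group: the least ordinal `α` with `Z_α(G) = G`. -/
noncomputable def hypercentralLength.{u} (G : Type u) [Group G] : Ordinal.{u} :=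
  sInf {α : Ordinal.{u} | upperCentral G α = ⊤}

/-- `G` has a subgroup of finite index that is hypercentral of length less than `α`. -/
def IsVirtuallyHypercentralOfLengthLT.{u} (G : Type u) [Group G] (α : Ordinal.{u}) : Prop :=
  ∃ H : Subgroup G, H.FiniteIndex ∧ IsHypercentral H ∧ hypercentralLength H < α

end Monotiles

/-! The existence claims go through `IsTileClass`: a family of finite sets containing `{1}` in which
every member tiles members as right-invariant as desired. Iterated extension inside such a family
gives a locally monotileable Følner sequence. Intervals form one in an infinite cyclic group, and
multiplying by a transversal carries one from a subgroup to a finite-index overgroup.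

The core is `IsCentralChain.hasTileClass`: a group with a continuous ascending central series `N α`
has a tile class once all factors have one. The members are the finite sets that, modulo every `N
β`, have the form `A * T` with `A` a tile of the factor `N (β + 1) / N β` and `T` injecting into `G
⧸ N (β + 1)`. To extend such an `F`, start in the trivial quotient and descend. At a successor the
tiling lifts through a central extension (`IsFibered.exists_lift`); at a limit the finitely many
relations involved already hold modulo an earlier `N β`. Ordinals being well-founded, finitely many
steps reach `G`. Used once with cyclic factors this settles countable abelian groups, and used again
with abelian factors it settles countable hypercentral groups.

Local monotileability implies congruence by translation: for `m` large, some tile in a tiling of `F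
m` has a centre `c` with `c * s ∈ F m`, and `c⁻¹ • F m` then contains `s` and has `1` among its
tiling centres (`IsRightFolnerSeq.exists_mul_mem`). -/

namespace Monotiles

open Set

/-! ### Elementary properties of tilings. -/

section Tilings

variable {G : Type*} [Group G]

theorem isTiling_iff {C T V : Set G} :
    IsTiling C T V ↔ (∀ c ∈ C, ∀ c' ∈ C, ∀ x ∈ T, ∀ y ∈ T, c * x = c' * y → c = c') ∧
      ∀ v, v ∈ V ↔ ∃ c ∈ C, ∃ x ∈ T, c * x = v := by
  refine and_congr ⟨fun h c hc c' hc' x hx y hy hxy => ?_, fun h c hc c' hc' hne => ?_⟩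
    ⟨fun h v => ?_, fun h => ?_⟩
  · by_contra hne
    exact Set.disjoint_left.1 (h hc hc' hne) ⟨x, hx, rfl⟩ ⟨y, hy, hxy.symm⟩
  · refine Set.disjoint_left.2 ?_
    rintro _ ⟨x, hx, rfl⟩ ⟨y, hy, hxy⟩
    exact hne (h c hc c' hc' x hx y hy hxy.symm)
  · rw [← h]
    simp only [Set.mem_iUnion, Set.mem_smul_set, smul_eq_mul, exists_prop]
  · ext v
    rw [h]
    simp only [Set.mem_iUnion, Set.mem_smul_set, smul_eq_mul, exists_prop]

theorem IsMonotile.refl (T : Set G) : IsMonotile T T :=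
  ⟨{1}, isTiling_iff.2 ⟨by simp, by simp⟩⟩

theorem isMonotile_one (V : Set G) : IsMonotile {1} V :=
  ⟨V, isTiling_iff.2 ⟨by simp, by simp⟩⟩

theorem IsMonotile.trans {T V W : Set G} (h : IsMonotile T V) (h' : IsMonotile V W) :
    IsMonotile T W := by
  obtain ⟨C, hC⟩ := h
  obtain ⟨D, hD⟩ := h'
  rw [isTiling_iff] at hC hD
  refine ⟨D * C, isTiling_iff.2 ⟨?_, fun v => ?_⟩⟩
  · rintro _ ⟨d, hd, c, hc, rfl⟩ _ ⟨d', hd', c', hc', rfl⟩ x hx y hy hxy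
    simp only [mul_assoc] at hxy ⊢
    have := hD.1 d hd d' hd' _ ((hC.2 _).2 ⟨c, hc, x, hx, rfl⟩) _ ((hC.2 _).2 ⟨c', hc', y, hy, rfl⟩)
      hxy
    subst this
    rw [hC.1 c hc c' hc' x hx y hy (mul_left_cancel hxy)]
  · rw [hD.2]
    constructor
    · rintro ⟨d, hd, w, hw, rfl⟩
      obtain ⟨c, hc, x, hx, rfl⟩ := (hC.2 _).1 hw
      exact ⟨d * c, ⟨d, hd, c, hc, rfl⟩, x, hx, mul_assoc _ _ _⟩
    · rintro ⟨_, ⟨d, hd, c, hc, rfl⟩, x, hx, rfl⟩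
      exact ⟨d, hd, c * x, (hC.2 _).2 ⟨c, hc, x, hx, rfl⟩, (mul_assoc _ _ _).symm⟩

/-- Left translation of the tile and of the tiled set. -/
theorem IsTiling.smul {C T V : Set G} (h : IsTiling C T V) (g k : G) :
    IsTiling {c | k⁻¹ * c * g ∈ C} (g • T) (k • V) := by
  rw [isTiling_iff] at h ⊢
  refine ⟨?_, fun v => ?_⟩
  · rintro c hc c' hc' _ ⟨x, hx, rfl⟩ _ ⟨y, hy, rfl⟩ hxy
    simp only [smul_eq_mul] at hxy
    have := h.1 _ hc _ hc' x hx y hy (by simpa [mul_assoc] using hxy)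
    simpa using this
  · rw [Set.mem_smul_set_iff_inv_smul_mem, smul_eq_mul, h.2]
    constructor
    · rintro ⟨c, hc, x, hx, hv⟩
      refine ⟨k * c * g⁻¹, by simpa [mul_assoc] using hc, g • x, ⟨x, hx, rfl⟩, ?_⟩
      rw [smul_eq_mul, mul_assoc, inv_mul_cancel_left, mul_assoc, hv, mul_inv_cancel_left]
    · rintro ⟨c, hc, _, ⟨x, hx, rfl⟩, rfl⟩
      exact ⟨_, hc, x, hx, by simp [mul_assoc]⟩

theorem IsMonotile.of_image {H : Type*} [Group H] {φ : G →* H} (hφ : Function.Bijective φ)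
    {T V : Set G} (h : IsMonotile (φ '' T) (φ '' V)) : IsMonotile T V := by
  obtain ⟨C, hC⟩ := h
  rw [isTiling_iff] at hC
  refine ⟨φ ⁻¹' C, isTiling_iff.2 ⟨fun c hc c' hc' x hx y hy hxy => ?_, fun v => ?_⟩⟩
  · exact hφ.1 (hC.1 _ hc _ hc' _ ⟨x, hx, rfl⟩ _ ⟨y, hy, rfl⟩ (by rw [← map_mul, hxy, map_mul]))
  · rw [← hφ.1.mem_set_image, hC.2]
    constructor
    · rintro ⟨c, hc, _, ⟨x, hx, rfl⟩, hv⟩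
      obtain ⟨c, rfl⟩ := hφ.2 c
      exact ⟨c, hc, x, hx, hφ.1 (by rw [map_mul, hv])⟩
    · rintro ⟨c, hc, x, hx, rfl⟩
      exact ⟨_, hc, _, ⟨x, hx, rfl⟩, (map_mul _ _ _).symm⟩

theorem IsTiling.ncard_eq {C T V : Set G} (h : IsTiling C T V) :
    V.ncard = C.ncard * T.ncard := by
  rw [isTiling_iff] at h
  have : V = (fun p : G × G => p.1 * p.2) '' (C ×ˢ T) := by
    ext v
    rw [h.2]
    simp only [Set.mem_image, Set.mem_prod, Prod.exists]
    exact ⟨fun ⟨c, hc, x, hx, e⟩ => ⟨c, x, ⟨hc, hx⟩, e⟩, fun ⟨c, x, ⟨hc, hx⟩, e⟩ => ⟨c, hc, x, hx, e⟩⟩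
  rw [this, Set.InjOn.ncard_image, Set.ncard_prod]
  rintro ⟨c, x⟩ ⟨hc, hx⟩ ⟨c', x'⟩ ⟨hc', hx'⟩ hxy
  simp only at hxy hc hx hc' hx'
  obtain rfl := h.1 c hc c' hc' x hx x' hx' hxy
  rw [mul_left_cancel hxy]

end Tilings

/-! ### Almost invariance of product sets. -/

section AlmostInvariant

variable {G : Type*} [Group G]

/-- `F` is almost invariant under right multiplication by elements of `S`, with error `ε`. -/
def IsAlmostInvariant (S : Set G) (ε : ℝ) (F : Set G) : Prop :=
  ∀ s ∈ S, ((((fun x => x * s) '' F) \ F).ncard : ℝ) ≤ ε * F.ncard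

theorem IsAlmostInvariant.mono {S S' : Set G} {ε ε' : ℝ} {F : Set G}
    (h : IsAlmostInvariant S ε F) (hS : S' ⊆ S) (hε : ε ≤ ε') : IsAlmostInvariant S' ε' F :=
  fun s hs => (h s (hS hs)).trans (by gcongr)

theorem IsAlmostInvariant.of_image {H : Type*} [Group H] {φ : G →* H}
    (hφ : Function.Injective φ) {S F : Set G} {ε : ℝ} (h : IsAlmostInvariant (φ '' S) ε (φ '' F)) :
    IsAlmostInvariant S ε F := by
  intro s hs
  have := h _ ⟨s, hs, rfl⟩
  rwa [Set.image_image, show (fun x => φ x * φ s) = fun x => φ (x * s) by simp,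
    ← Set.image_image (fun x => φ x) (fun x => x * s), ← Set.image_sdiff hφ,
    Set.ncard_image_of_injective _ hφ, Set.ncard_image_of_injective _ hφ] at this

/-- Almost invariance of a product set `B * T`, where `B` lies in a subgroup `M` and `T` consists
of representatives of distinct right cosets of `M`. -/
theorem ncard_image_mul_sdiff_le {M : Subgroup G} {B : Set M} {T : Set G} (hB : B.Finite)
    (hT : T.Finite)
    (hinj : ∀ m m' : M, ∀ t ∈ T, ∀ t' ∈ T, (m : G) * t = m' * t' → m = m' ∧ t = t')
    (s : G) {η δ : ℝ} (hδ : 0 ≤ δ)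
    (hbad : ({t ∈ T | ∀ z : M, ∀ t' ∈ T, t * s ≠ z * t'}.ncard : ℝ) ≤ η * T.ncard)
    (hgood : ∀ z : M, (∃ t ∈ T, ∃ t' ∈ T, t * s = z * t') →
      ((((fun x => x * z) '' B) \ B).ncard : ℝ) ≤ δ * B.ncard)
    {F : Set G} (hF : F = image2 (fun (b : M) t => (b : G) * t) B T) :
    ((((fun x => x * s) '' F) \ F).ncard : ℝ) ≤ (η + δ) * F.ncard := by
  classical
  have hcard : F.ncard = B.ncard * T.ncard := by
    rw [hF, ← Set.image_prod, Set.InjOn.ncard_image, Set.ncard_prod]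
    rintro ⟨b, t⟩ ⟨-, ht⟩ ⟨b', t'⟩ ⟨-, ht'⟩ h
    obtain ⟨rfl, rfl⟩ := hinj b b' t ht t' ht' h
    rfl
  set Tb : Set G := {t ∈ T | ∀ z : M, ∀ t' ∈ T, t * s ≠ z * t'} with hTb
  have key : ∀ t : G, ∃ z : M, ∃ t' : G, t ∈ T \ Tb → t' ∈ T ∧ t * s = z * t' := by
    intro t
    by_cases ht : t ∈ T \ Tb
    · have := ht.2
      simp only [hTb, Set.mem_ofPred_eq, not_and, not_forall, not_not] at this
      obtain ⟨z, t', h', h⟩ := this ht.1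
      exact ⟨z, t', fun _ => ⟨h', h⟩⟩
    · exact ⟨1, 1, fun h => absurd h ht⟩
  choose z t' hzt using key
  -- If `t * s = z * t'`, then `b * t * s = (b * z) * t'` can leave `F` only when `b * z` leaves
  -- `B`. All other losses lie over the bad set `Tb`.
  have hsub : ((fun x => x * s) '' F) \ F ⊆
      ((fun p : M × G => (p.1 : G) * p.2 * s) '' (B ×ˢ Tb)) ∪
        ⋃ t ∈ hT.toFinset, if t ∈ Tb then ∅ else
          (fun b : M => (b : G) * t' t) '' (((fun x => x * z t) '' B) \ B) := by
    rintro _ ⟨⟨x, hx, rfl⟩, hxs⟩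
    rw [hF] at hx hxs
    obtain ⟨b, hb, t, ht, rfl⟩ := hx
    by_cases htb : t ∈ Tb
    · exact Or.inl ⟨(b, t), ⟨hb, htb⟩, rfl⟩
    · refine Or.inr ?_
      simp only [Set.mem_iUnion]
      refine ⟨t, by simpa using ht, ?_⟩
      rw [if_neg htb]
      obtain ⟨ht', he⟩ := hzt t ⟨ht, htb⟩
      have he2 : (b : G) * t * s = ((b * z t : M) : G) * t' t := by
        rw [mul_assoc, he]; simp [mul_assoc]
      refine ⟨b * z t, ⟨⟨b, hb, rfl⟩, fun hbz => hxs ?_⟩, he2.symm⟩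
      exact ⟨b * z t, hbz, t' t, ht', he2.symm⟩
  have hTbfin : Tb.Finite := hT.subset (Set.sep_subset _ _)
  have h2 : ((⋃ t ∈ hT.toFinset, if t ∈ Tb then ∅ else
      (fun b : M => (b : G) * t' t) '' (((fun x => x * z t) '' B) \ B)).ncard : ℝ) ≤
        T.ncard * (δ * B.ncard) := by
    calc _ ≤ ((∑ t ∈ hT.toFinset, (if t ∈ Tb then ∅ else
      (fun b : M => (b : G) * t' t) '' (((fun x => x * z t) '' B) \ B)).ncard : ℕ) : ℝ) := by
          exact_mod_cast Finset.set_ncard_biUnion_le _ _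
      _ ≤ ∑ t ∈ hT.toFinset, δ * B.ncard := by
          push_cast
          refine Finset.sum_le_sum fun t ht => ?_
          have ht : t ∈ T := by simpa using ht
          split_ifs with htb
          · simp only [Set.ncard_empty, Nat.cast_zero]; positivity
          · obtain ⟨h, h'⟩ := hzt t ⟨ht, htb⟩
            refine le_trans ?_ (hgood (z t) ⟨t, ht, t' t, h, h'⟩)
            exact_mod_cast Set.ncard_image_le ((hB.image _).sdiff)
      _ = _ := by
          rw [Finset.sum_const, nsmul_eq_mul, Set.ncard_eq_toFinset_card T hT]
  have h1 : ((((fun p : M × G => (p.1 : G) * p.2 * s) '' (B ×ˢ Tb))).ncard : ℝ) ≤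
      B.ncard * (η * T.ncard) := by
    calc _ ≤ ((B ×ˢ Tb).ncard : ℝ) := by exact_mod_cast Set.ncard_image_le (hB.prod hTbfin)
      _ = B.ncard * Tb.ncard := by rw [Set.ncard_prod]; push_cast; rfl
      _ ≤ _ := by gcongr
  have hfin : (((fun p : M × G => (p.1 : G) * p.2 * s) '' (B ×ˢ Tb)) ∪
        ⋃ t ∈ hT.toFinset, if t ∈ Tb then ∅ else
          (fun b : M => (b : G) * t' t) '' (((fun x => x * z t) '' B) \ B)).Finite := by
    refine ((hB.prod hTbfin).image _).union (Set.Finite.biUnion (Finset.finite_toSet _) ?_)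
    intro t _
    split_ifs
    · exact Set.finite_empty
    · exact ((hB.image _).sdiff).image _
  have h3 := (Set.ncard_le_ncard hsub hfin).trans (Set.ncard_union_le _ _)
  have h4 : ((((fun x => x * s) '' F) \ F).ncard : ℝ) ≤
      B.ncard * (η * T.ncard) + T.ncard * (δ * B.ncard) :=
    (Nat.cast_le.2 h3).trans (by push_cast; exact add_le_add h1 h2)
  rw [hcard]
  push_cast
  linarith

end AlmostInvariant

/-! ### Tile classes: finite groups, cyclic groups, finite-index overgroups. -/

section TileClass

/-- A family of finite sets in which every member tiles arbitrarily invariant members. -/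
structure IsTileClass {G : Type*} [Group G] (𝒜 : Set (Set G)) : Prop where
  one_mem : {1} ∈ 𝒜
  finite : ∀ A ∈ 𝒜, A.Finite
  nonempty : ∀ A ∈ 𝒜, A.Nonempty
  extend : ∀ A ∈ 𝒜, ∀ S : Set G, S.Finite → ∀ ε : ℝ, 0 < ε →
    ∃ B ∈ 𝒜, IsMonotile A B ∧ IsAlmostInvariant S ε B

/-- The group has a family of finite sets in which every member tiles arbitrarily invariant
members. -/
def HasTileClass (G : Type*) [Group G] : Prop :=
  ∃ 𝒜 : Set (Set G), IsTileClass 𝒜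

variable {G : Type*} [Group G]

theorem HasTileClass.of_finite [Finite G] : HasTileClass G := by
  refine ⟨{{1}, univ}, by simp, fun A _ => Set.toFinite A, ?_, fun A hA S _ ε hε => ?_⟩
  · rintro A (rfl | rfl) <;> simp
  · refine ⟨univ, by simp, ?_, fun s _ => ?_⟩
    · rcases hA with rfl | rfl
      exacts [isMonotile_one _, IsMonotile.refl _]
    · rw [Set.sdiff_univ]
      simp only [Set.ncard_empty, Nat.cast_zero]
      positivity

theorem HasTileClass.of_isCyclic [IsCyclic G] : HasTileClass G := by
  rcases finite_or_infinite G with hfin | hinf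
  · exact HasTileClass.of_finite
  obtain ⟨g, hg⟩ := IsCyclic.exists_generator (α := G)
  have hinj : Function.Injective (fun i : ℤ => g ^ i) := by
    rw [injective_zpow_iff_not_isOfFinOrder]
    intro h
    exact Set.infinite_univ ((finite_zpowers.2 h).subset fun x _ => hg x)
  let A : ℕ → Set G := fun n => (fun i : ℤ => g ^ i) '' Set.Ico 0 (n : ℤ)
  have hcard : ∀ n, (A n).ncard = n := fun n => by
    rw [Set.ncard_image_of_injective _ hinj, ← Finset.coe_Ico, Set.ncard_coe_finset]
    simp
  refine ⟨{B | ∃ n : ℕ, 0 < n ∧ B = A n}, ⟨1, one_pos, ?_⟩, ?_, ?_, ?_⟩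
  · have : Set.Ico (0 : ℤ) ((1 : ℕ) : ℤ) = {0} := by ext; simp; omega
    simp only [A, this, Set.image_singleton, zpow_zero]
  · rintro _ ⟨n, -, rfl⟩
    exact (Set.finite_Ico _ _).image _
  · rintro _ ⟨n, hn, rfl⟩
    exact ⟨_, 0, ⟨le_rfl, by exact_mod_cast hn⟩, rfl⟩
  · rintro _ ⟨n, hn, rfl⟩ S hS ε hε
    have hk : ∀ s : G, ∃ k : ℤ, g ^ k = s := fun s => hg s
    choose k hk using hk
    obtain ⟨b, hb⟩ := (hS.image fun s => |k s|).bddAbove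
    obtain ⟨m, hm⟩ := exists_nat_gt ((b : ℝ) / ε)
    have hmpos : 0 < m + 1 := Nat.succ_pos m
    -- The length is a multiple of `n`, so that intervals of length `n` tile, and exceeds `b / ε`,
    -- while a shift by `k s` moves at most `b` points out of the interval.
    refine ⟨A (n * (m + 1)), ⟨_, by positivity, rfl⟩, ⟨(fun j : ℤ => g ^ ((n : ℤ) * j)) ''
      Set.Ico 0 ((m + 1 : ℕ) : ℤ), isTiling_iff.2 ⟨?_, fun v => ?_⟩⟩, fun s hs => ?_⟩
    · rintro _ ⟨i, hi, rfl⟩ _ ⟨j, hj, rfl⟩ _ ⟨x, hx, rfl⟩ _ ⟨y, hy, rfl⟩ h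
      simp only [← zpow_add] at h ⊢
      have h := hinj h
      have hij : i = j := by
        have h1 : ((n : ℤ) * i + x) / n = i := by
          rw [Int.mul_add_ediv_left _ _ (by positivity), Int.ediv_eq_zero_of_lt hx.1 hx.2, add_zero]
        have h2 : ((n : ℤ) * j + y) / n = j := by
          rw [Int.mul_add_ediv_left _ _ (by positivity), Int.ediv_eq_zero_of_lt hy.1 hy.2, add_zero]
        rw [← h1, ← h2, h]
      rw [hij]
    · constructor
      · rintro ⟨i, ⟨h0, h1⟩, rfl⟩
        have hn' : (0 : ℤ) < n := by exact_mod_cast hn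
        refine ⟨_, ⟨i / n, ⟨Int.ediv_nonneg h0 hn'.le, ?_⟩, rfl⟩, _, ⟨i % n,
          ⟨Int.emod_nonneg _ hn'.ne', Int.emod_lt_of_pos _ hn'⟩, rfl⟩, ?_⟩
        · rw [Int.ediv_lt_iff_lt_mul hn']
          push_cast at h1 ⊢
          linarith
        · simp only [← zpow_add, Int.mul_ediv_add_emod]
      · rintro ⟨_, ⟨j, ⟨h0, h1⟩, rfl⟩, _, ⟨i, ⟨h2, h3⟩, rfl⟩, rfl⟩
        refine ⟨n * j + i, ⟨by positivity, ?_⟩, by simp only [zpow_add]⟩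
        have : (n : ℤ) * j ≤ n * m := by
          push_cast at h1
          gcongr
          omega
        push_cast
        linarith
    · have hks : |k s| ≤ b := hb ⟨s, hs, rfl⟩
      rw [hcard]
      set M : ℕ := n * (m + 1)
      have hsub : ((fun x => x * s) '' A M) \ A M ⊆
          (fun i : ℤ => g ^ i) '' (Set.Ico (k s) 0 ∪ Set.Ico (M : ℤ) (M + k s)) := by
        rintro _ ⟨⟨_, ⟨i, ⟨h0, h1⟩, rfl⟩, rfl⟩, hx⟩
        rw [← hk s] at hx ⊢
        simp only [← zpow_add] at hx ⊢
        refine ⟨i + k s, ?_, rfl⟩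
        have : ¬ (0 ≤ i + k s ∧ i + k s < M) := fun h => hx ⟨_, h, rfl⟩
        simp only [Set.mem_union, Set.mem_Ico]
        rw [hk]
        omega
      have h1 : (((fun x => x * s) '' A M) \ A M).ncard ≤ (k s).natAbs := by
        refine (Set.ncard_le_ncard hsub
          (((Set.finite_Ico _ _).union (Set.finite_Ico _ _)).image _)).trans ?_
        rw [Set.ncard_image_of_injective _ hinj]
        refine (Set.ncard_union_le _ _).trans ?_
        rw [← Finset.coe_Ico, ← Finset.coe_Ico, Set.ncard_coe_finset, Set.ncard_coe_finset,
          Int.card_Ico, Int.card_Ico]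
        omega
      have h2 : ((k s).natAbs : ℝ) ≤ b := by
        rw [Nat.cast_natAbs]
        exact_mod_cast hks
      rw [div_lt_iff₀ hε] at hm
      have h3 : (m : ℝ) ≤ M := by
        have : m ≤ M := by
          calc m ≤ m + 1 := by omega
            _ ≤ n * (m + 1) := Nat.le_mul_of_pos_left _ hn
        exact_mod_cast this
      calc ((((fun x => x * s) '' A M) \ A M).ncard : ℝ) ≤ (k s).natAbs := by exact_mod_cast h1
        _ ≤ b := h2
        _ ≤ m * ε := hm.le
        _ ≤ M * ε := by gcongr
        _ = _ := mul_comm _ _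

/-- Tile classes pass to overgroups of finite index. -/
theorem HasTileClass.of_finiteIndex (H : Subgroup G) [H.FiniteIndex] (h : HasTileClass H) :
    HasTileClass G := by
  obtain ⟨𝒜, h𝒜⟩ := h
  obtain ⟨T, hT, -⟩ := H.exists_isComplement_right 1
  have hTfin : T.Finite := hT.finite_right_iff.2 inferInstance
  have hinj : ∀ m m' : H, ∀ t ∈ T, ∀ t' ∈ T, (m : G) * t = m' * t' → m = m' ∧ t = t' := by
    intro m m' t ht t' ht' h
    have := @hT.1 (m, ⟨t, ht⟩) (m', ⟨t', ht'⟩) h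
    simpa using this
  have hne : T.Nonempty := by
    obtain ⟨⟨-, t⟩, -⟩ := hT.2 1
    exact ⟨t, t.2⟩
  let P : Set H → Set G := fun A => image2 (fun (b : H) t => (b : G) * t) A T
  have hext : ∀ A ∈ 𝒜, ∀ S : Set G, S.Finite → ∀ ε : ℝ, 0 < ε →
      ∃ B ∈ 𝒜, IsMonotile A B ∧ IsAlmostInvariant S ε (P B) := by
    intro A hA S hS ε hε
    -- Right multiplication by `S` acts on the transversal up to these finitely many factors in `H`;
    -- invariance of `B` under them suffices.
    have hZ : {z : H | ∃ s ∈ S, ∃ t ∈ T, ∃ t' ∈ T, t * s = z * t'}.Finite := by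
      refine Set.Finite.of_finite_image (f := ((↑) : H → G)) (((hTfin.mul hS).mul hTfin.inv).subset
        ?_) Subtype.val_injective.injOn
      rintro _ ⟨z, ⟨s, hs, t, ht, t', ht', h⟩, rfl⟩
      exact ⟨t * s, ⟨t, ht, s, hs, rfl⟩, t'⁻¹, by simpa using ht', by simp [h]⟩
    obtain ⟨B, hB, hAB, hinv⟩ := h𝒜.extend A hA _ hZ ε hε
    refine ⟨B, hB, hAB, fun s hs => ?_⟩
    have := ncard_image_mul_sdiff_le (h𝒜.finite B hB) hTfin hinj s (η := 0) hε.le ?_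
      (fun z ⟨t, ht, t', ht', h⟩ => hinv z ⟨s, hs, t, ht, t', ht', h⟩) (F := P B) rfl
    · simpa using this
    · rw [zero_mul]
      have : {t ∈ T | ∀ z : H, ∀ t' ∈ T, t * s ≠ z * t'} = ∅ := by
        refine Set.eq_empty_of_forall_notMem fun t ht => ?_
        obtain ⟨⟨z, t'⟩, h⟩ := hT.2 (t * s)
        exact ht.2 ⟨z, z.2⟩ t' t'.2 h.symm
      rw [this, Set.ncard_empty, Nat.cast_zero]
  -- The set `{1}` need not be of the form `P A`; it is added by hand, which is harmless because it
  -- tiles everything.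
  refine ⟨insert {1} (P '' 𝒜), Set.mem_insert _ _, ?_, ?_, ?_⟩
  · rintro _ (rfl | ⟨A, hA, rfl⟩)
    exacts [Set.finite_singleton _, (h𝒜.finite A hA).image2 _ hTfin]
  · rintro _ (rfl | ⟨A, hA, rfl⟩)
    exacts [Set.singleton_nonempty _, (h𝒜.nonempty A hA).image2 hne]
  · rintro _ (rfl | ⟨A, hA, rfl⟩) S hS ε hε
    · obtain ⟨B, hB, -, h⟩ := hext _ h𝒜.one_mem S hS ε hε
      exact ⟨P B, Or.inr ⟨B, hB, rfl⟩, isMonotile_one _, h⟩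
    · obtain ⟨B, hB, ⟨C, hC⟩, h⟩ := hext A hA S hS ε hε
      refine ⟨P B, Or.inr ⟨B, hB, rfl⟩, ⟨(↑) '' C, ?_⟩, h⟩
      rw [isTiling_iff] at hC ⊢
      refine ⟨?_, fun v => ?_⟩
      · rintro _ ⟨c, hc, rfl⟩ _ ⟨c', hc', rfl⟩ _ ⟨a, ha, t, ht, rfl⟩ _ ⟨a', ha', t', ht', rfl⟩ h
        have := (hinj (c * a) (c' * a') t ht t' ht' (by simpa [mul_assoc] using h)).1
        rw [hC.1 c hc c' hc' a ha a' ha' this]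
      · constructor
        · rintro ⟨b, hb, t, ht, rfl⟩
          obtain ⟨c, hc, a, ha, rfl⟩ := (hC.2 b).1 hb
          exact ⟨c, ⟨c, hc, rfl⟩, _, ⟨a, ha, t, ht, rfl⟩, by simp [mul_assoc]⟩
        · rintro ⟨_, ⟨c, hc, rfl⟩, _, ⟨a, ha, t, ht, rfl⟩, rfl⟩
          exact ⟨c * a, (hC.2 _).2 ⟨c, hc, a, ha, rfl⟩, t, ht, by simp [mul_assoc]⟩

end TileClass

/-! ### Lifting tilings through a central extension. -/

section CentralExtension

variable {Γ Q : Type*} [Group Γ] [Group Q]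

/-- `F` is a product `A * T` with `A` in the given family of subsets of the kernel of `π` and `T`
a finite set on which `π` is injective. -/
def IsFibered (π : Γ →* Q) (𝒜 : Set (Set π.ker)) (F : Set Γ) : Prop :=
  ∃ A ∈ 𝒜, ∃ T : Set Γ, T.Finite ∧ InjOn π T ∧ F = image2 (fun (a : π.ker) t => (a : Γ) * t) A T

theorem IsFibered.of_injOn {π : Γ →* Q} {𝒜 : Set (Set π.ker)} (h𝒜 : {1} ∈ 𝒜) {F : Set Γ}
    (hF : F.Finite) (hπ : InjOn π F) : IsFibered π 𝒜 F :=
  ⟨{1}, h𝒜, F, hF, hπ, by simp⟩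

/-- Lifting a tiling along a central extension. -/
theorem IsFibered.exists_lift {π : Γ →* Q} (hπ : Function.Surjective π)
    (hc : π.ker ≤ Subgroup.center Γ) {𝒜 : Set (Set π.ker)} (h𝒜 : IsTileClass 𝒜) {F : Set Γ}
    (hF : IsFibered π 𝒜 F) {P : Set Q} (hP : P.Finite) (hFP : IsMonotile (π '' F) P)
    {S : Set Γ} (hS : S.Finite) {η η' : ℝ} (hη : η < η') (hinv : IsAlmostInvariant (π '' S) η P) :
    ∃ F' : Set Γ, F'.Finite ∧ IsFibered π 𝒜 F' ∧ π '' F' = P ∧ IsMonotile F F' ∧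
      IsAlmostInvariant S η' F' := by
  have himage : ∀ A ∈ 𝒜, ∀ T : Set Γ,
      π '' image2 (fun (a : π.ker) t => (a : Γ) * t) A T = π '' T := by
    intro A hA T
    obtain ⟨a, ha⟩ := h𝒜.nonempty A hA
    ext q
    constructor
    · rintro ⟨_, ⟨b, -, t, ht, rfl⟩, rfl⟩
      exact ⟨t, ht, by rw [map_mul, b.2, one_mul]⟩
    · rintro ⟨t, ht, rfl⟩
      exact ⟨_, ⟨a, ha, t, ht, rfl⟩, by rw [map_mul, a.2, one_mul]⟩
  have hcomm : ∀ (a : π.ker) (x : Γ), x * a = a * x := fun a x =>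
    Subgroup.mem_center_iff.1 (hc a.2) x
  obtain ⟨A, hA, T, hT, hTi, rfl⟩ := hF
  rw [himage A hA] at hFP
  obtain ⟨L, hL⟩ := hFP
  rw [isTiling_iff] at hL
  set σ := Function.surjInv hπ with hσ
  have hπσ : ∀ l, π (σ l) = l := Function.surjInv_eq hπ
  -- Lifting only the centres `L` keeps the given `T` inside the new set of representatives, and `π`
  -- maps `T'` bijectively onto `P`.
  set T' : Set Γ := image2 (fun l t => σ l * t) L T with hT'
  have hLT : ∀ l ∈ L, ∀ l' ∈ L, ∀ t ∈ T, ∀ t' ∈ T, l * π t = l' * π t' → l = l' ∧ t = t' := by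
    intro l hl l' hl' t ht t' ht' h
    obtain rfl := hL.1 l hl l' hl' _ ⟨t, ht, rfl⟩ _ ⟨t', ht', rfl⟩ h
    exact ⟨rfl, hTi ht ht' (mul_left_cancel h)⟩
  have hT'P : π '' T' = P := by
    ext q
    rw [hL.2]
    constructor
    · rintro ⟨_, ⟨l, hl, t, ht, rfl⟩, rfl⟩
      exact ⟨l, hl, π t, ⟨t, ht, rfl⟩, by rw [map_mul, hπσ]⟩
    · rintro ⟨l, hl, _, ⟨t, ht, rfl⟩, rfl⟩
      exact ⟨_, ⟨l, hl, t, ht, rfl⟩, by rw [map_mul, hπσ]⟩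
  have hT'i : InjOn π T' := by
    rintro _ ⟨l, hl, t, ht, rfl⟩ _ ⟨l', hl', t', ht', rfl⟩ h
    simp only [map_mul, hπσ] at h
    obtain ⟨rfl, rfl⟩ := hLT l hl l' hl' t ht t' ht' h
    rfl
  have hT'fin : T'.Finite := Set.Finite.of_finite_image (hT'P ▸ hP) hT'i
  have hinj : ∀ m m' : π.ker, ∀ t ∈ T', ∀ t' ∈ T', (m : Γ) * t = m' * t' → m = m' ∧ t = t' := by
    intro m m' t ht t' ht' h
    have h' := congrArg π h
    rw [map_mul, map_mul, m.2, m'.2, one_mul, one_mul] at h'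
    obtain rfl := hT'i ht ht' h'
    exact ⟨Subtype.ext (mul_right_cancel h), rfl⟩
  have hZ : {z : π.ker | ∃ s ∈ S, ∃ t ∈ T', ∃ t' ∈ T', t * s = z * t'}.Finite := by
    refine Set.Finite.of_finite_image (f := ((↑) : π.ker → Γ))
      (((hT'fin.mul hS).mul hT'fin.inv).subset ?_) Subtype.val_injective.injOn
    rintro _ ⟨z, ⟨s, hs, t, ht, t', ht', h⟩, rfl⟩
    exact ⟨t * s, ⟨t, ht, s, hs, rfl⟩, t'⁻¹, by simpa using ht', by simp [h]⟩
  -- The kernel direction absorbs the cocycle elements `t * s * t'⁻¹`, at the cost of the remaining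
  -- error `η' - η`.
  obtain ⟨B, hB, ⟨C, hC⟩, hBinv⟩ := h𝒜.extend A hA _ hZ (η' - η) (sub_pos.2 hη)
  rw [isTiling_iff] at hC
  -- By centrality `B * T' = C * A * σ(L) * T = σ(L) * C * (A * T)`, so `σ(L) * C` is a set of
  -- centres for `F = A * T`.
  refine ⟨_, (h𝒜.finite B hB).image2 _ hT'fin, ⟨B, hB, T', hT'fin, hT'i, rfl⟩,
    (himage B hB T').trans hT'P, ⟨image2 (fun l (c : π.ker) => σ l * c) L C,
      isTiling_iff.2 ⟨?_, fun v => ?_⟩⟩, fun s hs => ?_⟩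
  · rintro _ ⟨l, hl, c, hc, rfl⟩ _ ⟨l', hl', c', hc', rfl⟩ _ ⟨a, ha, t, ht, rfl⟩ _
      ⟨a', ha', t', ht', rfl⟩ h
    have h' := congrArg π h
    simp only [map_mul, hπσ, MonoidHom.mem_ker.1 c.2, MonoidHom.mem_ker.1 c'.2,
      MonoidHom.mem_ker.1 a.2, MonoidHom.mem_ker.1 a'.2, one_mul, mul_one] at h'
    obtain ⟨rfl, rfl⟩ := hLT l hl l' hl' t ht t' ht' h'
    have h2 : c * a = c' * a' := by
      refine Subtype.ext (mul_right_cancel (b := t) (mul_left_cancel (a := σ l) ?_))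
      simpa [mul_assoc] using h
    rw [hC.1 c hc c' hc' a ha a' ha' h2]
  · constructor
    · rintro ⟨b, hb, _, ⟨l, hl, t, ht, rfl⟩, rfl⟩
      obtain ⟨c, hc, a, ha, rfl⟩ := (hC.2 b).1 hb
      refine ⟨_, ⟨l, hl, c, hc, rfl⟩, _, ⟨a, ha, t, ht, rfl⟩, ?_⟩
      have := hcomm (c * a) (σ l)
      push_cast at this ⊢
      rw [← mul_assoc _ (σ l) t, ← this]
      simp only [mul_assoc]
    · rintro ⟨_, ⟨l, hl, c, hc, rfl⟩, _, ⟨a, ha, t, ht, rfl⟩, rfl⟩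
      refine ⟨c * a, (hC.2 _).2 ⟨c, hc, a, ha, rfl⟩, _, ⟨l, hl, t, ht, rfl⟩, ?_⟩
      have := hcomm (c * a) (σ l)
      push_cast at this ⊢
      rw [← mul_assoc _ (σ l) t, ← this]
      simp only [mul_assoc]
  · have hPT : P.ncard = T'.ncard := by rw [← hT'P, hT'i.ncard_image]
    have := ncard_image_mul_sdiff_le (h𝒜.finite B hB) hT'fin hinj s (η := η) (sub_pos.2 hη).le ?_
      (fun z ⟨t, ht, t', ht', h⟩ => hBinv z ⟨s, hs, t, ht, t', ht', h⟩) rfl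
    · simpa using this
    · rw [← hPT]
      refine le_trans ?_ (hinv (π s) ⟨s, hs, rfl⟩)
      rw [Nat.cast_le]
      -- A representative `t` with `t * s` outside `ker π * T'` maps to a point of `P` that `π s`
      -- moves out of `P`.
      refine Set.ncard_le_ncard_of_injOn (fun t => π t * π s) ?_ ?_ ((hP.image _).sdiff)
      · rintro t ⟨ht, hbad⟩
        refine ⟨⟨π t, hT'P ▸ ⟨t, ht, rfl⟩, rfl⟩, fun h => ?_⟩
        rw [← hT'P] at h
        obtain ⟨t', ht', h⟩ := h
        refine hbad ⟨t * s * t'⁻¹, ?_⟩ t' ht' (by simp)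
        rw [MonoidHom.mem_ker, map_mul, map_mul, map_inv, h, mul_inv_cancel]
      · intro t ht t' ht' h
        exact hT'i ht.1 ht'.1 (mul_right_cancel h)

theorem IsAlmostInvariant.of_image_injOn {φ : Γ →* Q} {S X : Set Γ} {η : ℝ} (hX : X.Finite)
    (hφ : InjOn φ X) (hS : ∀ x ∈ X, ∀ s ∈ S, φ (x * s) ∈ φ '' X → x * s ∈ X)
    (h : IsAlmostInvariant (φ '' S) η (φ '' X)) : IsAlmostInvariant S η X := by
  intro s hs
  have := h _ ⟨s, hs, rfl⟩
  rw [hφ.ncard_image] at this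
  refine le_trans ?_ this
  rw [Nat.cast_le]
  refine Set.ncard_le_ncard_of_injOn φ ?_ ?_ (((hX.image _).image _).sdiff)
  · rintro _ ⟨⟨x, hx, rfl⟩, hxs⟩
    exact ⟨⟨φ x, ⟨x, hx, rfl⟩, (map_mul _ _ _).symm⟩, fun h => hxs (hS x hx s hs h)⟩
  · rintro _ ⟨⟨x, hx, rfl⟩, -⟩ _ ⟨⟨y, hy, rfl⟩, -⟩ h
    simp only [map_mul, mul_left_inj] at h ⊢
    exact hφ hx hy h

end CentralExtension

/-! ### Descent along a transfinite central series. -/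

section Chain

variable {G : Type*} [Group G]

/-- The canonical map between quotients by nested normal subgroups. -/
def quotientMap {N N' : Subgroup G} [N.Normal] [N'.Normal] (h : N ≤ N') : G ⧸ N →* G ⧸ N' :=
  QuotientGroup.map N N' (MonoidHom.id G) h

theorem quotientMap_mk' {N N' : Subgroup G} [N.Normal] [N'.Normal] (h : N ≤ N') (g : G) :
    quotientMap h (QuotientGroup.mk' N g) = QuotientGroup.mk' N' g :=
  rfl

theorem quotientMap_surjective {N N' : Subgroup G} [N.Normal] [N'.Normal] (h : N ≤ N') :
    Function.Surjective (quotientMap h) := by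
  intro x
  obtain ⟨g, rfl⟩ := QuotientGroup.mk'_surjective N' x
  exact ⟨QuotientGroup.mk' N g, rfl⟩

theorem image_quotientMap {N N' : Subgroup G} [N.Normal] [N'.Normal] (h : N ≤ N') (F : Set G) :
    quotientMap h '' (QuotientGroup.mk' N '' F) = QuotientGroup.mk' N' '' F := by
  rw [Set.image_image]
  rfl

/-- A continuous transfinite ascending central series reaching the whole group. -/
structure IsCentralChain.{v} (N : Ordinal.{v} → Subgroup G) [∀ α, (N α).Normal] : Prop where
  zero : N 0 = ⊥
  mono : Monotone N
  limit : ∀ α, Order.IsSuccLimit α → ∀ x ∈ N α, ∃ β < α, x ∈ N β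
  succ : ∀ α, ∀ x ∈ N (α + 1), ∀ g, (g * x)⁻¹ * (x * g) ∈ N α
  top : ∃ α, N α = ⊤

namespace IsCentralChain

universe v
variable {N : Ordinal.{v} → Subgroup G} [∀ α, (N α).Normal]

/-- The map `G ⧸ N α → G ⧸ N (α + 1)`. -/
def succMap (hN : IsCentralChain N) (α : Ordinal.{v}) : G ⧸ N α →* G ⧸ N (α + 1) :=
  quotientMap (hN.mono le_self_add)

theorem ker_succMap_le_center (hN : IsCentralChain N) (α : Ordinal.{v}) :
    (hN.succMap α).ker ≤ Subgroup.center _ := by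
  intro x hx
  obtain ⟨g, rfl⟩ := QuotientGroup.mk'_surjective _ x
  have hg : g ∈ N (α + 1) := (QuotientGroup.eq_one_iff g).1 hx
  rw [Subgroup.mem_center_iff]
  intro y
  obtain ⟨h, rfl⟩ := QuotientGroup.mk'_surjective _ y
  rw [← map_mul, ← map_mul]
  exact QuotientGroup.eq.2 (hN.succ α g hg h)

/-- At a limit `N α` is the union of the increasing earlier terms, so finitely many memberships are
witnessed at one common stage. -/
theorem exists_lt_of_finite (hN : IsCentralChain N) {α : Ordinal.{v}} (hα : Order.IsSuccLimit α)
    {E : Set G} (hE : E.Finite) : ∃ β < α, ∀ e ∈ E, e ∈ N α → e ∈ N β := by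
  induction E, hE using Set.Finite.induction_on with
  | empty => exact ⟨0, hα.bot_lt, by simp⟩
  | @insert e E _ _ ih =>
    obtain ⟨β, hβ, h⟩ := ih
    by_cases he : e ∈ N α
    · obtain ⟨γ, hγ, heγ⟩ := hN.limit α hα e he
      refine ⟨max β γ, max_lt hβ hγ, ?_⟩
      rintro x (rfl | hx) hxα
      exacts [hN.mono (le_max_right _ _) heγ, hN.mono (le_max_left _ _) (h x hx hxα)]
    · refine ⟨β, hβ, ?_⟩
      rintro x (rfl | hx) hxα
      exacts [absurd hxα he, h x hx hxα]

/-- `F` is fibered over each factor of index at least `α` of the chain. -/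
def IsGoodAbove (hN : IsCentralChain N) (𝒜 : ∀ α, Set (Set (hN.succMap α).ker)) (α : Ordinal.{v})
    (F : Set G) : Prop :=
  ∀ β, α ≤ β → IsFibered (hN.succMap β) (𝒜 β) (QuotientGroup.mk' (N β) '' F)

/-- Modulo `N α` there is a set fibered over the factors above `α` which is tiled by `F` and almost
invariant. -/
def HasExtension (hN : IsCentralChain N) (𝒜 : ∀ α, Set (Set (hN.succMap α).ker)) (F S : Set G)
    (α : Ordinal.{v}) (η : ℝ) : Prop :=
  ∃ F' : Set G, F'.Finite ∧ F'.Nonempty ∧ hN.IsGoodAbove 𝒜 α F' ∧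
    IsMonotile (QuotientGroup.mk' (N α) '' F) (QuotientGroup.mk' (N α) '' F') ∧
    IsAlmostInvariant (QuotientGroup.mk' (N α) '' S) η (QuotientGroup.mk' (N α) '' F')

variable {hN : IsCentralChain N} {𝒜 : ∀ α, Set (Set (hN.succMap α).ker)} {F S : Set G}
  {α : Ordinal.{v}} {η η' : ℝ}

theorem IsGoodAbove.of_image_eq {F' : Set G} {β : Ordinal.{v}} (h : hN.IsGoodAbove 𝒜 β F)
    (hαβ : α ≤ β) (hF : QuotientGroup.mk' (N α) '' F' = QuotientGroup.mk' (N α) '' F) :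
    hN.IsGoodAbove 𝒜 β F' := by
  intro γ hγ
  rw [← image_quotientMap (hN.mono (hαβ.trans hγ)), hF, image_quotientMap]
  exact h γ hγ

/-- The factor at `α` is central, so `IsFibered.exists_lift` applies to the image of `F`; this is
where goodness of `F` at the level `α` enters. Above `α` nothing changes, since the lift has the
same image modulo `N (α + 1)`. -/
theorem HasExtension.succ (h𝒜 : ∀ α, IsTileClass (𝒜 α)) (hF : hN.IsGoodAbove 𝒜 0 F)
    (hS : S.Finite) (hη : η < η') (h : hN.HasExtension 𝒜 F S (α + 1) η) :
    hN.HasExtension 𝒜 F S α η' := by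
  obtain ⟨F₁, hfin, hne₁, hgood, htile, hinv⟩ := h
  have hle : N α ≤ N (α + 1) := hN.mono le_self_add
  rw [← image_quotientMap hle F] at htile
  rw [← image_quotientMap hle S] at hinv
  obtain ⟨X, hX, hXf, hXF, hXtile, hXinv⟩ := (hF α zero_le).exists_lift
    (quotientMap_surjective hle) (hN.ker_succMap_le_center α) (h𝒜 α) (hfin.image _) htile
    (hS.image _) hη hinv
  set σ := Function.surjInv (QuotientGroup.mk'_surjective (N α))
  have hσ : QuotientGroup.mk' (N α) '' (σ '' X) = X := by
    rw [Set.image_image]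
    simp only [σ, Function.surjInv_eq, Set.image_id']
  refine ⟨σ '' X, hX.image _, Set.Nonempty.image _ ?_, fun β hβ => ?_, by rwa [hσ], by rwa [hσ]⟩
  · exact Set.image_nonempty.1 (hXF ▸ hne₁.image _)
  rcases hβ.eq_or_lt with rfl | hlt
  · rwa [hσ]
  · refine hgood.of_image_eq le_rfl ?_ β (Order.add_one_le_of_lt hlt)
    rw [← image_quotientMap hle, hσ]
    exact hXF

/-- The tiling and the invariance modulo `N α` rest on finitely many congruences, all valid modulo
some earlier `N β`; hence `η` does not grow. -/
theorem HasExtension.exists_lt (h𝒜 : ∀ α, IsTileClass (𝒜 α)) (hF : F.Finite)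
    (hS : S.Finite) (hα : Order.IsSuccLimit α)
    (h : hN.HasExtension 𝒜 F S α η) : ∃ β < α, hN.HasExtension 𝒜 F S β η := by
  obtain ⟨F₁, hfin, hne₁, hgood, ⟨L, hL⟩, hinv⟩ := h
  rw [isTiling_iff] at hL
  set σ := Function.surjInv (QuotientGroup.mk'_surjective (N α))
  have hσ : ∀ l, QuotientGroup.mk' (N α) (σ l) = l := Function.surjInv_eq _
  -- Using only representatives of `F` modulo `N α` makes the lift `F'` injective modulo `N α`.
  obtain ⟨F₀, hF₀F, hF₀⟩ := Set.exists_subset_bijOn F (QuotientGroup.mk' (N α))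
  set F' : Set G := image2 (fun l f => σ l * f) L F₀ with hF'
  have himage : QuotientGroup.mk' (N α) '' F' = QuotientGroup.mk' (N α) '' F₁ := by
    ext v
    rw [hL.2, ← hF₀.image_eq]
    constructor
    · rintro ⟨_, ⟨l, hl, f, hf, rfl⟩, rfl⟩
      exact ⟨l, hl, _, ⟨f, hf, rfl⟩, by rw [map_mul, hσ]⟩
    · rintro ⟨l, hl, _, ⟨f, hf, rfl⟩, rfl⟩
      exact ⟨_, ⟨l, hl, f, hf, rfl⟩, by rw [map_mul, hσ]⟩
  have hinj : InjOn (QuotientGroup.mk' (N α)) F' := by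
    rintro _ ⟨l, hl, f, hf, rfl⟩ _ ⟨l', hl', f', hf', rfl⟩ h
    simp only [map_mul, hσ] at h
    obtain rfl := hL.1 l hl l' hl' _ ⟨f, hF₀F hf, rfl⟩ _ ⟨f', hF₀F hf', rfl⟩ h
    rw [hF₀.injOn hf hf' (mul_left_cancel h)]
  have hF'fin : F'.Finite := Set.Finite.of_finite_image (himage ▸ hfin.image _) hinj
  -- The first set of quotients makes `F` and `F₀` agree modulo `N β`; the second ensures that `x *
  -- s` falls into `F'` modulo `N β` whenever it does modulo `N α`.
  obtain ⟨β, hβ, hE⟩ := hN.exists_lt_of_finite hα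
    ((hF.inv.mul hF).union ((hF'fin.mul hS).inv.mul hF'fin))
  have hle := hN.mono hβ.le
  refine ⟨β, hβ, F', hF'fin, Set.image_nonempty.1 (himage ▸ hne₁.image _), fun γ hγ => ?_, ⟨(fun l => QuotientGroup.mk' (N β) (σ l)) '' L,
    isTiling_iff.2 ⟨?_, fun v => ?_⟩⟩, ?_⟩
  · rcases lt_or_ge γ α with hγα | hγα
    -- For levels below `α`, injectivity of `F'` modulo `N α` makes it fibered with trivial kernel
    -- part `{1}`.
    · refine IsFibered.of_injOn (h𝒜 γ).one_mem (hF'fin.image _) ?_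
      rintro _ ⟨x, hx, rfl⟩ _ ⟨y, hy, rfl⟩ h
      have h2 := congrArg (quotientMap (hN.mono (Order.add_one_le_of_lt hγα))) h
      rw [hinj hx hy h2]
    · exact hgood.of_image_eq le_rfl himage γ hγα
  · rintro _ ⟨l, hl, rfl⟩ _ ⟨l', hl', rfl⟩ _ ⟨f, hf, rfl⟩ _ ⟨f', hf', rfl⟩ h
    have h2 := congrArg (quotientMap hle) h
    simp only [map_mul, quotientMap_mk', hσ] at h2
    rw [hL.1 l hl l' hl' _ ⟨f, hf, rfl⟩ _ ⟨f', hf', rfl⟩ h2]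
  · constructor
    · rintro ⟨_, ⟨l, hl, f, hf, rfl⟩, rfl⟩
      exact ⟨_, ⟨l, hl, rfl⟩, _, ⟨f, hF₀F hf, rfl⟩, (map_mul _ _ _).symm⟩
    · rintro ⟨_, ⟨l, hl, rfl⟩, _, ⟨f, hf, rfl⟩, rfl⟩
      obtain ⟨f', hf', h⟩ := hF₀.surjOn ⟨f, hf, rfl⟩
      have h2 : QuotientGroup.mk' (N β) f' = QuotientGroup.mk' (N β) f :=
        QuotientGroup.eq.2 (hE _ (Or.inl ⟨f'⁻¹, by simpa using hF₀F hf', f, hf, rfl⟩)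
          (QuotientGroup.eq.1 h))
      exact ⟨_, ⟨l, hl, f', hf', rfl⟩, by rw [map_mul, h2]⟩
  · refine IsAlmostInvariant.of_image_injOn (φ := quotientMap hle) (hF'fin.image _) ?_ ?_ ?_
    · rintro _ ⟨x, hx, rfl⟩ _ ⟨y, hy, rfl⟩ h
      rw [hinj hx hy h]
    · rintro _ ⟨x, hx, rfl⟩ _ ⟨s, hs, rfl⟩ ⟨_, ⟨y, hy, rfl⟩, h⟩
      refine ⟨y, hy, ?_⟩
      rw [← map_mul] at h ⊢
      refine (QuotientGroup.eq.2 (hE _ (Or.inr ⟨(x * s)⁻¹, ?_, y, hy, rfl⟩)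
        (QuotientGroup.eq.1 h.symm))).symm
      exact Set.inv_mem_inv.2 ⟨x, hx, s, hs, rfl⟩
    · rwa [image_quotientMap, image_quotientMap, himage]

/-- Well-founded descent. Only successor steps cost accuracy, and each time `exists_between` leaves
a positive part of the budget. -/
theorem HasExtension.zero (h𝒜 : ∀ α, IsTileClass (𝒜 α)) (hF : F.Finite)
    (hgood : hN.IsGoodAbove 𝒜 0 F) (hS : S.Finite) (hη : η < η')
    (h : hN.HasExtension 𝒜 F S α η) : hN.HasExtension 𝒜 F S 0 η' := by
  induction α using WellFoundedLT.induction generalizing η with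
  | ind α ih =>
    rcases Ordinal.zero_or_succ_or_isSuccLimit α with rfl | ⟨β, rfl⟩ | hα
    · obtain ⟨F', h0, h1, h2, h3, h4⟩ := h
      exact ⟨F', h0, h1, h2, h3, h4.mono subset_rfl hη.le⟩
    · obtain ⟨θ, hθ, hθ'⟩ := exists_between hη
      exact ih β (Order.lt_add_one_iff.2 le_rfl) hθ' (h.succ h𝒜 hgood hS hθ)
    · obtain ⟨β, hβ, hβ'⟩ := h.exists_lt h𝒜 hF hS hα
      exact ih β hβ hη hβ'

theorem hasTileClass (hN : IsCentralChain N) (h : ∀ α, HasTileClass (hN.succMap α).ker) :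
    HasTileClass G := by
  choose 𝒜 h𝒜 using h
  have hone : ∀ α, hN.IsGoodAbove 𝒜 α {1} := fun α β _ =>
    IsFibered.of_injOn (h𝒜 β).one_mem ((Set.finite_singleton _).image _) (by simp)
  refine ⟨{F | F.Finite ∧ F.Nonempty ∧ hN.IsGoodAbove 𝒜 0 F},
    ⟨Set.finite_singleton _, Set.singleton_nonempty _, hone 0⟩, fun A hA => hA.1,
    fun A hA => hA.2.1, ?_⟩
  rintro F ⟨hF, hne, hgood⟩ S hS ε hε
  obtain ⟨α, hα⟩ := hN.top
  have hsub : Subsingleton (G ⧸ N α) := by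
    rw [hα]
    exact QuotientGroup.subsingleton_quotient_top
  -- In the trivial quotient the one-point set is tiled by the image of `F` and exactly invariant.
  have hbase : hN.HasExtension 𝒜 F S α 0 := by
    refine ⟨{1}, Set.finite_singleton _, Set.singleton_nonempty _, hone α, ?_, fun s _ => ?_⟩
    · have h1 : QuotientGroup.mk' (N α) '' F = {1} :=
        (Set.subsingleton_of_subsingleton.eq_empty_or_singleton.resolve_left
          (hne.image _).ne_empty).elim fun x hx => hx.trans (by rw [Subsingleton.elim x 1])
      rw [h1]
      exact isMonotile_one _
    · have : ((fun x => x * s) '' (QuotientGroup.mk' (N α) '' {1})) \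
          (QuotientGroup.mk' (N α) '' {1}) = ∅ := by
        refine Set.eq_empty_of_forall_notMem fun x hx => hx.2 ⟨1, rfl, Subsingleton.elim _ _⟩
      rw [this, Set.ncard_empty, Nat.cast_zero, zero_mul]
  obtain ⟨F', hF', hne', hgood', htile, hinv⟩ := hbase.zero h𝒜 hF hgood hS hε
  have hbij : Function.Bijective (QuotientGroup.mk' (N 0)) := by
    refine ⟨?_, QuotientGroup.mk'_surjective _⟩
    rw [← MonoidHom.ker_eq_bot_iff, QuotientGroup.ker_mk', hN.zero]
  have htile' := IsMonotile.of_image hbij htile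
  exact ⟨F', ⟨hF', hne', hgood'⟩, htile', hinv.of_image hbij.1⟩

end IsCentralChain

end Chain

/-! ### Countable abelian groups and countable groups with a central chain. -/

section Abelian

/-- Adjoining the elements of an enumeration one at a time gives a chain that reaches the group at
`ω` and has cyclic factors. -/
theorem HasTileClass.of_comm {G : Type*} [Group G] [Countable G]
    (hcomm : ∀ a b : G, a * b = b * a) : HasTileClass G := by
  obtain ⟨s, hs⟩ := exists_surjective_nat G
  let N : Ordinal.{0} → Subgroup G := fun α =>
    Subgroup.closure {x | ∃ k : ℕ, (k : Ordinal) < α ∧ s k = x}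
  have : ∀ α, (N α).Normal := fun α => ⟨fun n hn g => by rwa [hcomm g, mul_inv_cancel_right]⟩
  have hmono : Monotone N := fun α β h =>
    Subgroup.closure_mono fun x ⟨k, hk, hx⟩ => ⟨k, hk.trans_le h, hx⟩
  have hN : IsCentralChain N := by
    refine ⟨?_, hmono, fun α hα x hx => ?_, fun α x _ g => ?_, Ordinal.omega0, ?_⟩
    · simp [N]
    · induction hx using Subgroup.closure_induction with
      | mem x hx =>
        obtain ⟨k, hk, rfl⟩ := hx
        exact ⟨k + 1, hα.add_one_lt hk,
          Subgroup.subset_closure ⟨k, Order.lt_add_one_iff.2 le_rfl, rfl⟩⟩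
      | one => exact ⟨0, hα.bot_lt, one_mem _⟩
      | mul x y _ _ hx hy =>
        obtain ⟨β, hβ, hx⟩ := hx
        obtain ⟨γ, hγ, hy⟩ := hy
        exact ⟨max β γ, max_lt hβ hγ,
          mul_mem (hmono (le_max_left _ _) hx) (hmono (le_max_right _ _) hy)⟩
      | inv x _ hx =>
        obtain ⟨β, hβ, hx⟩ := hx
        exact ⟨β, hβ, inv_mem hx⟩
    · rw [hcomm g x, inv_mul_cancel]
      exact one_mem _
    · rw [eq_top_iff]
      intro x _
      obtain ⟨k, rfl⟩ := hs x
      exact Subgroup.subset_closure ⟨k, Ordinal.natCast_lt_omega0 k, rfl⟩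
  refine hN.hasTileClass fun α => ?_
  suffices h : ∃ u, (hN.succMap α).ker ≤ Subgroup.zpowers u by
    obtain ⟨u, hu⟩ := h
    have := Subgroup.isCyclic_of_le hu
    exact HasTileClass.of_isCyclic
  have key : ∀ t : G, (∀ k : ℕ, (k : Ordinal.{0}) = α → s k = t) →
      (hN.succMap α).ker ≤ Subgroup.zpowers (QuotientGroup.mk' (N α) t) := by
    intro t ht x hx
    obtain ⟨g, rfl⟩ := QuotientGroup.mk'_surjective _ x
    have hg : g ∈ N (α + 1) := (QuotientGroup.eq_one_iff g).1 hx
    have hle : N (α + 1) ≤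
        (Subgroup.zpowers (QuotientGroup.mk' (N α) t)).comap (QuotientGroup.mk' (N α)) := by
      refine (Subgroup.closure_le _).2 ?_
      rintro _ ⟨k, hk, rfl⟩
      rcases (Order.lt_add_one_iff.1 hk).eq_or_lt with h | h
      · rw [ht k h]
        exact Subgroup.mem_zpowers _
      · have : QuotientGroup.mk' (N α) (s k) = 1 :=
          (QuotientGroup.eq_one_iff _).2 (Subgroup.subset_closure ⟨k, h, rfl⟩)
        change QuotientGroup.mk' (N α) (s k) ∈ Subgroup.zpowers (QuotientGroup.mk' (N α) t)
        rw [this]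
        exact one_mem _
    exact hle hg
  by_cases hα : ∃ k : ℕ, (k : Ordinal.{0}) = α
  · obtain ⟨k, rfl⟩ := hα
    exact ⟨_, key (s k) fun j hj => by rw [Nat.cast_injective hj]⟩
  -- From `ω` on no element is adjoined, so the factor is trivial.
  · exact ⟨_, key 1 fun k hk => absurd ⟨k, hk⟩ hα⟩

theorem IsCentralChain.hasTileClass_of_countable.{v} {G : Type*} [Group G] [Countable G]
    {N : Ordinal.{v} → Subgroup G} [∀ α, (N α).Normal] (hN : IsCentralChain N) :
    HasTileClass G := by
  refine hN.hasTileClass fun α => ?_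
  have : Countable (G ⧸ N α) := (QuotientGroup.mk'_surjective (N α)).countable
  refine HasTileClass.of_comm fun a b => Subtype.ext ?_
  exact (Subgroup.mem_center_iff.1 (hN.ker_succMap_le_center α a.2) b).symm

end Abelian

/-! ### The upper central series as a central chain. -/

section Hypercentral

universe u v
variable (G : Type u) [Group G]

theorem upperCentral_monotone : Monotone (upperCentral.{u, v} G) := by
  suffices h : ∀ β α : Ordinal.{v}, α ≤ β → upperCentral G α ≤ upperCentral G β from
    fun α β => h β α
  intro β
  induction β using Ordinal.limitRecOn with
  | zero =>
    intro α hα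
    rw [le_antisymm hα zero_le]
  | add_one β ih =>
    intro α hα
    rcases hα.eq_or_lt with rfl | hlt
    · exact le_rfl
    · refine (ih α (Order.lt_add_one_iff.1 hlt)).trans ?_
      rw [upperCentral_succ]
      intro x hx
      have h1 : QuotientGroup.mk' (upperCentral G β) x = 1 := (QuotientGroup.eq_one_iff x).2 hx
      rw [Subgroup.mem_comap, h1]
      exact one_mem _
  | limit β hβ ih =>
    intro α hα
    rcases hα.eq_or_lt with rfl | hlt
    · exact le_rfl
    · rw [upperCentral_limit G β hβ]
      exact le_iSup (fun γ : Set.Iio β => upperCentral G γ.1) ⟨α, hlt⟩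

variable {G}

theorem IsHypercentral.isCentralChain (h : IsHypercentral G) :
    IsCentralChain (upperCentral.{u, u} G) := by
  refine ⟨upperCentral_zero G, upperCentral_monotone G, fun α hα x hx => ?_, fun α x hx g => ?_, h⟩
  · rw [upperCentral_limit G α hα] at hx
    have : Nonempty (Set.Iio α) := ⟨⟨0, hα.bot_lt⟩⟩
    rw [Subgroup.mem_iSup_of_directed] at hx
    · obtain ⟨β, hβ⟩ := hx
      exact ⟨β, β.2, hβ⟩
    · intro β γ
      exact ⟨max β γ, upperCentral_monotone G (le_max_left β γ),
        upperCentral_monotone G (le_max_right β γ)⟩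
  · rw [upperCentral_succ, Subgroup.mem_comap, Subgroup.mem_center_iff] at hx
    exact QuotientGroup.eq.1 (hx g)

/-- The bridge by which nilpotent groups are seen to be hypercentral. -/
theorem upperCentral_natCast (n : ℕ) :
    upperCentral.{u, v} G n = Subgroup.upperCentralSeries G n := by
  induction n with
  | zero => simp [upperCentral_zero]
  | succ n ih =>
    ext x
    rw [Nat.cast_succ, upperCentral_succ, Subgroup.mem_comap, Subgroup.mem_center_iff,
      Subgroup.mem_upperCentralSeries_succ_iff, ← ih]
    constructor
    · intro h y
      have := h (QuotientGroup.mk' _ y)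
      rw [← QuotientGroup.eq_one_iff]
      change QuotientGroup.mk' _ (x * y * x⁻¹ * y⁻¹) = 1
      rw [map_mul, map_mul, map_mul, ← this, map_inv, map_inv]
      group
    · intro h y
      obtain ⟨y, rfl⟩ := QuotientGroup.mk'_surjective _ y
      have := (QuotientGroup.eq_one_iff _).2 (h y)
      change QuotientGroup.mk' _ (x * y * x⁻¹ * y⁻¹) = 1 at this
      rw [map_mul, map_mul, map_mul, map_inv, map_inv, mul_inv_eq_one, mul_inv_eq_iff_eq_mul] at this
      exact this.symm

theorem isHypercentral_of_isNilpotent [Group.IsNilpotent G] : IsHypercentral G := by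
  obtain ⟨n, hn⟩ := Group.IsNilpotent.nilpotent (G := G)
  exact ⟨n, (upperCentral_natCast n).trans hn⟩

end Hypercentral

/-! ### From tile classes to Følner sequences, and from local to congruent monotileability. -/

section Sequences

variable {G : Type*} [Group G]

theorem HasTileClass.isLocallyMonotileable [Countable G] (h : HasTileClass G) :
    IsLocallyMonotileable G := by
  obtain ⟨𝒜, h𝒜⟩ := h
  obtain ⟨s, hs⟩ := exists_surjective_nat G
  -- Stage `n` demands error `1 / (n + 1)` for the first `n + 1` elements of the enumeration, so
  -- every fixed element is eventually controlled.
  choose! E hE hEt hEi using fun (n : ℕ) A hA =>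
    h𝒜.extend A hA (s '' Set.Iic n) ((Set.finite_Iic n).image s) (1 / (n + 1 : ℝ)) (by positivity)
  let B : ℕ → Set G := fun n => Nat.rec {1} (fun n A => E n A) n
  have hB : ∀ n, B n ∈ 𝒜 := by
    intro n
    induction n with
    | zero => exact h𝒜.one_mem
    | succ n ih => exact hE n _ ih
  have hfin := fun n => h𝒜.finite _ (hB n)
  refine ⟨fun n => (hfin n).toFinset, ⟨fun n => by simpa using h𝒜.nonempty _ (hB n), fun g => ?_⟩,
    ?_, fun n => ?_⟩
  · obtain ⟨k, rfl⟩ := hs g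
    simp only [Set.Finite.coe_toFinset, ← Set.ncard_eq_toFinset_card]
    rw [← Filter.tendsto_add_atTop_iff_nat 1]
    refine squeeze_zero' (Filter.Eventually.of_forall fun n => by positivity) ?_
      tendsto_one_div_add_atTop_nhds_zero_nat
    filter_upwards [Filter.eventually_ge_atTop k] with n hn
    have hpos : (0 : ℝ) < (B (n + 1)).ncard := by
      exact_mod_cast (Set.ncard_pos (hfin (n + 1))).2 (h𝒜.nonempty _ (hB (n + 1)))
    rw [div_le_iff₀ hpos]
    exact hEi n _ (hB n) _ ⟨k, hn, rfl⟩
  · refine Finset.coe_injective ?_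
    rw [Set.Finite.coe_toFinset, Finset.coe_singleton]
    rfl
  · simpa using hEt n _ (hB n)

/-- The hypothesis on `g` says `1 ∈ g • F n`, so the centres of a tiling of `F m` lie in `F m` and
make up the proportion `1 / |F n|` of it. Once fewer points than that are moved out by `s`, some
centre stays inside. -/
theorem IsRightFolnerSeq.exists_mul_mem {F : ℕ → Finset G} (hF : IsRightFolnerSeq F)
    (htile : ∀ n, IsMonotile (F n : Set G) (F (n + 1) : Set G)) (n : ℕ) (g s : G)
    (hg : g⁻¹ ∈ F n) : ∃ m > n, ∃ h : G, s ∈ h • (F m : Set G) ∧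
      ∃ K : Set G, 1 ∈ K ∧ IsTiling K (g • (F n : Set G)) (h • (F m : Set G)) := by
  have hmono : ∀ m ≥ n, IsMonotile (F n : Set G) (F m) := by
    intro m hm
    induction m, hm using Nat.le_induction with
    | base => exact IsMonotile.refl _
    | succ m _ ih => exact ih.trans (htile m)
  have hcard : ∀ m, (0 : ℝ) < (F m).card := fun m => by exact_mod_cast (hF.1 m).card_pos
  obtain ⟨m, hm, hnm⟩ := (((hF.2 s).eventually_lt_const
    (one_div_pos.2 (hcard n))).and (Filter.eventually_gt_atTop n)).exists
  obtain ⟨C, hC⟩ := hmono m hnm.le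
  have hC1 := hC.smul g 1
  rw [one_smul] at hC1
  set D : Set G := {c | 1⁻¹ * c * g ∈ C}
  have hD := hC1.ncard_eq
  have hC2 := isTiling_iff.1 hC1
  have h1 : (1 : G) ∈ g • (F n : Set G) := ⟨g⁻¹, hg, mul_inv_cancel g⟩
  have hDF : D ⊆ F m := fun c hc => (hC2.2 c).2 ⟨c, hc, 1, h1, mul_one c⟩
  obtain ⟨c, hc, hcs⟩ : ∃ c ∈ D, c * s ∈ F m := by
    by_contra! hcon
    have hle : D.ncard ≤ (((fun x => x * s) '' (F m : Set G)) \ (F m : Set G)).ncard := by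
      refine Set.ncard_le_ncard_of_injOn (fun x => x * s)
        (fun c hc => ⟨⟨c, hDF hc, rfl⟩, hcon c hc⟩) (mul_left_injective s).injOn
        (((F m).finite_toSet.image _).sdiff)
    rw [div_lt_div_iff₀ (hcard m) (hcard n), one_mul] at hm
    have hgn : (g • (F n : Set G)).ncard = (F n).card := by
      rw [← Set.ncard_coe_finset]
      exact Set.ncard_image_of_injective _ (mul_right_injective g)
    rw [Set.ncard_coe_finset, hgn] at hD
    rw [hD] at hm
    have hm' : (((fun x => x * s) '' (F m : Set G)) \ (F m : Set G)).ncard * (F n).card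
        < D.ncard * (F n).card := by exact_mod_cast hm
    exact absurd (lt_of_mul_lt_mul_right' hm') (not_lt.2 hle)
  -- Translating by `c⁻¹` moves the centre `c` to `1` and the point `c * s` to `s`.
  refine ⟨m, hnm, c⁻¹, ⟨c * s, hcs, inv_mul_cancel_left c s⟩, {d | c⁻¹⁻¹ * d * 1 ∈ D}, ?_, ?_⟩
  · simpa using hc
  · simpa only [one_smul] using hC1.smul 1 c⁻¹

/-- Passing to a subsequence and to left translates preserves the right Følner property. Each stage
absorbs one more element of an enumeration, which gives exhaustion. -/
theorem IsLocallyMonotileable.isCongruentMonotileable [Countable G]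
    (h : IsLocallyMonotileable G) : IsCongruentMonotileable G := by
  classical
  obtain ⟨F, hF, hF0, htile⟩ := h
  obtain ⟨s, hs⟩ := exists_surjective_nat G
  -- Pairs `(n, g)` with `1 ∈ g • F n`: the condition needed to repeat the extension step.
  let X := {p : ℕ × G // p.2⁻¹ ∈ F p.1}
  let E : X → Set G := fun p => p.1.2 • (F p.1.1 : Set G)
  have hE1 : ∀ p, (1 : G) ∈ E p := fun p => ⟨p.1.2⁻¹, p.2, mul_inv_cancel _⟩
  have hstep : ∀ (k : ℕ) (p : X), ∃ q : X, p.1.1 < q.1.1 ∧ s k ∈ E q ∧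
      ∃ K : Set G, 1 ∈ K ∧ IsTiling K (E p) (E q) := by
    rintro k ⟨⟨n, g⟩, hg⟩
    obtain ⟨m, hm, h, hsk, K, hK1, hK⟩ := hF.exists_mul_mem htile n g (s k) hg
    have h1 : (1 : G) ∈ h • (F m : Set G) :=
      ((isTiling_iff.1 hK).2 1).2 ⟨1, hK1, 1, ⟨g⁻¹, hg, mul_inv_cancel g⟩, one_mul 1⟩
    rw [Set.mem_smul_set_iff_inv_smul_mem, smul_eq_mul, mul_one] at h1
    exact ⟨⟨⟨m, h⟩, h1⟩, hm, hsk, K, hK1, hK⟩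
  choose q hq hsq K hK1 hK using hstep
  let p : ℕ → X := fun n => Nat.rec ⟨(0, 1), by simp [hF0]⟩ (fun k x => q k x) n
  have hfin : ∀ x, (E x).Finite := fun x => (Finset.finite_toSet _).image _
  have hKE : ∀ n, K n (p n) ⊆ E (p (n + 1)) := fun n k hk =>
    ((isTiling_iff.1 (hK n (p n))).2 k).2 ⟨k, hk, 1, hE1 _, mul_one k⟩
  have hKfin : ∀ n, (K n (p n)).Finite := fun n => (hfin _).subset (hKE n)
  have hcard : ∀ x : X, (hfin x).toFinset.card = (F x.1.1).card := fun x => by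
    rw [← Set.ncard_eq_toFinset_card _ (hfin x), ← Set.ncard_coe_finset]
    exact Set.ncard_image_of_injective _ (mul_right_injective x.1.2)
  have hp : StrictMono fun n => (p n).1.1 := strictMono_nat_of_lt_succ fun n => hq n (p n)
  have hp0 : E (p 0) = {1} := by simp [E, p, hF0]
  refine ⟨fun n => (hfin (p n)).toFinset, ⟨fun n => ⟨1, by simpa using hE1 (p n)⟩, fun g => ?_⟩,
    ⟨⟨Finset.coe_injective (by simpa using hp0), fun n => ?_⟩,
      fun n => Nat.casesOn n {1} fun n => (hKfin n).toFinset, ⟨rfl, fun n => ?_⟩, fun n => ?_⟩, ?_⟩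
  · refine ((hF.2 g).comp hp.tendsto_atTop).congr fun n => ?_
    simp only [Function.comp_apply, hcard, Set.Finite.coe_toFinset]
    congr 2
    have hinj : Function.Injective fun x => (p n).1.2 * x := mul_right_injective _
    rw [← Set.ncard_image_of_injective _ hinj, Set.image_sdiff hinj, Set.image_image]
    simp only [E, ← Set.image_smul, Set.image_image, smul_eq_mul, mul_assoc]
  · simpa using ⟨_, hK n (p n)⟩
  · simpa using hK n (p n)
  · cases n with
    | zero => simp
    | succ n => simpa using hK1 n (p n)
  · rw [IsExhaustiveSeq, Set.eq_univ_iff_forall]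
    intro g
    obtain ⟨k, rfl⟩ := hs g
    exact Set.mem_iUnion.2 ⟨k + 1, by simpa using hsq k (p k)⟩

theorem IsCongruentMonotileable.isLocallyMonotileable (h : IsCongruentMonotileable G) :
    IsLocallyMonotileable G := by
  obtain ⟨F, hF, hF', -⟩ := h
  exact ⟨F, hF, hF'.1⟩

/-- Countable virtually hypercentral groups are locally monotileable, whatever the length. -/
theorem isLocallyMonotileable_of_isHypercentral [Countable G] (H : Subgroup G) [H.FiniteIndex]
    (h : IsHypercentral H) : IsLocallyMonotileable G :=
  (HasTileClass.of_finiteIndex H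
    h.isCentralChain.hasTileClass_of_countable).isLocallyMonotileable

end Sequences

end Monotiles

theorem theorem1p6 {G : Type*} [Group G] [Countable G] :
    (Monotiles.IsLocallyMonotileable G ↔ Monotiles.IsCongruentMonotileable G) ∧
    (Monotiles.IsVirtuallyHypercentralOfLengthLT G (Ordinal.omega0 ^ (2 : Ordinal)) →
      Monotiles.IsLocallyMonotileable G ∧ Monotiles.IsCongruentMonotileable G) ∧
    (Group.IsVirtuallyNilpotent G → Monotiles.IsCongruentMonotileable G) := by
  refine ⟨⟨fun h => h.isCongruentMonotileable, fun h => h.isLocallyMonotileable⟩, ?_, ?_⟩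
  · rintro ⟨H, hfin, hH, -⟩
    have h := Monotiles.isLocallyMonotileable_of_isHypercentral H hH
    exact ⟨h, h.isCongruentMonotileable⟩
  · rintro ⟨H, hnil, hfin⟩
    exact (Monotiles.isLocallyMonotileable_of_isHypercentral H
      Monotiles.isHypercentral_of_isNilpotent).isCongruentMonotileable
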